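/- Let $s\ge1$, let $M$ be an irreducible $s\times s$ matrix with entries in $\{0,1\}$ (for all $i,j$ some power $M^n$, $n\ge1$, has a positive $(i,j)$ entry) and let $$\Sigma=\{x=(x_0,x_1,\dots)\in\{1,\dots,s\}^{\mathbb N} : M(x_j,x_{j+1})=1\ \ \forall j\ge 0\},\qquad \Sigma^*=\{y=(\dots,y_2,y_1) : M(y_{j+1},y_j)=1\ \ \forall j\ge1\},$$ $$\hat\Sigma=\{(y,x)\in\Sigma^*\times\Sigma : M(y_1,x_0)=1\},\qquad \pi(y,x)=x,\qquad \tau_y(x)=(y_1,x_0,x_1,\dots).$$ Fix $\lambda\in(0,1)$. The distance of two distinct sequences in $\Sigma$ is $\lambda^{k}$, where $k$ is the first index at which they differ; $\Sigma^*$ is metrized in the same way, and $\hat\Sigma$ by the maximum of the two distances. Let $\theta>0$ and let $A:\hat\Sigma\to\mathbb R$ be $\theta$-Hölder. A Borel probability measure $\mu$ on $\hat\Sigma$ is holonomic if $\int f(\tau_y(x))\,d\mu(y,x)=\int f(x)\,d\mu(y,x)$ for all $f\in C^0(\Sigma)$; $\bar A$ is the minimum of $\int A\,d\mu$ over holonomic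 probability measures. A continuous calibrated sub-action for $A$ is a continuous $u:\Sigma\to\mathbb R$ with $u(x)-u(\tau_y(x))\le A(y,x)-\bar A$ for all $(y,x)\in\hat\Sigma$ and $$u(x)=\min_{y:\,(y,x)\in\hat\Sigma}\big[u(\tau_y(x))+A(y,x)-\bar A\big]\qquad\forall x\in\Sigma.$$ For $\epsilon>0$, $x,x'\in\Sigma$ and $k\geq 1$, let $\mathcal P_k(x,x',\epsilon)$ be the set of sequences $(z^0,\dots,z^k)$ in $\hat\Sigma$, $z^i=(y^i,x^i)$, with $x^{i}=\tau_{y^{i+1}}(x^{i+1})$ for $0\le i<k$, $d(x^0,x)<\epsilon$ and $d(x^k,x')<\epsilon$. Let $\Omega(A)$ be the set of $x\in\Sigma$ such that for every $\epsilon>0$ there are $k\ge1$ and $(z^0,\dots,z^k)\in\mathcal P_k(x,x,\epsilon)$ with $\big|\sum_{i=1}^k(A-\bar A)(z^i)\big|<\epsilon$. The Peierls barrier $h_A:\Sigma\times\Sigma\to\mathbb R\cup\{+\infty\}$ is $$h_A(x,x')=\lim_{\epsilon\to0}\ \liminf_{k\to\infty}\ \inf\Big\{\sum_{i=1}^k(A-\bar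 A)(z^i) : (z^0,\dots,z^k)\in\mathcal P_k(x,x',\epsilon)\Big\}.$$ Then: 1. If $u$ is a continuous calibrated sub-action for $A$, then $u(x)=\min_{\bar x\in\Omega(A)}[u(\bar x)+h_A(\bar x,x)]$ for all $x\in\Sigma$. 2. Conversely, for every continuous $\phi:\Omega(A)\to\mathbb R$ with $\phi(x)-\phi(\bar x)\le h_A(\bar x,x)$ for all $x,\bar x\in\Omega(A)$, the function $u(x):=\min_{\bar x\in\Omega(A)}[\phi(\bar x)+h_A(\bar x,x)]$ is well defined (the minimum is attained and finite for every $x\in\Sigma$), it is a continuous calibrated sub-action for $A$, and $u=\phi$ on $\Omega(A)$. -/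

import Mathlib

open Filter Topology MeasureTheory

namespace Holonomic

variable {s : ℕ}

/-- The one-sided subshift of finite type with transition matrix `M`. It carries the topology and
the (Borel) σ-algebra induced by the product of the discrete alphabets. -/
abbrev Shift (M : Matrix (Fin s) (Fin s) ℤ) : Type :=
  {x : ℕ → Fin s // ∀ j, M (x j) (x (j + 1)) = 1}

/-- The dual subshift, whose points are the pasts `(…, y₃, y₂, y₁)`.
The letter `y_{j+1}` is stored as `y j`, so that `y₁` is `y 0`. -/
abbrev DualShift (M : Matrix (Fin s) (Fin s) ℤ) : Type :=
  {y : ℕ → Fin s // ∀ j, M (y (j + 1)) (y j) = 1}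

/-- The natural extension: the pairs `(y, x)` = `(…, y₂, y₁ | x₀, x₁, …)` with `M(y₁, x₀) = 1`. -/
abbrev NatExt (M : Matrix (Fin s) (Fin s) ℤ) : Type :=
  {z : DualShift M × Shift M // M (z.1.1 0) (z.2.1 0) = 1}

variable {M : Matrix (Fin s) (Fin s) ℤ}

/-- The σ-algebra used on the natural extension is its Borel σ-algebra. -/
theorem borelSpace_natExt (M : Matrix (Fin s) (Fin s) ℤ) : BorelSpace (NatExt M) := by
  have : SecondCountableTopology (Shift M) :=
    TopologicalSpace.Subtype.secondCountableTopology {x : ℕ → Fin s | ∀ j, M (x j) (x (j + 1)) = 1}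
  have : BorelSpace (DualShift M × Shift M) := Prod.borelSpace
  exact Subtype.borelSpace {z : DualShift M × Shift M | M (z.1.1 0) (z.2.1 0) = 1}

/-- The projection `π (y, x) = x`. -/
def proj (z : NatExt M) : Shift M := z.1.2

/-- The inverse branch `τ (y, x) = τ_y (x) = (y₁, x₀, x₁, …)`. -/
def tau (z : NatExt M) : Shift M :=
  ⟨fun n => Nat.casesOn n (z.1.1.1 0) (fun j => z.1.2.1 j), by
    intro j
    cases j with
    | zero => exact z.2
    | succ j => exact z.1.2.2 j⟩

/-- The distance `lam ^ min {j | x j ≠ x' j}` between sequences (and `0` if they are equal). -/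
noncomputable def seqDist (lam : ℝ) (x x' : ℕ → Fin s) : ℝ :=
  open Classical in if x = x' then 0 else lam ^ sInf {j | x j ≠ x' j}

/-- The maximum of the distances of the two components, on the natural extension. -/
noncomputable def extDist (lam : ℝ) (z z' : NatExt M) : ℝ :=
  max (seqDist lam z.1.1.1 z'.1.1.1) (seqDist lam z.1.2.1 z'.1.2.1)

/-- `A` is `θ`-Hölder on the natural extension. -/
def IsHolder (lam θ : ℝ) (A : NatExt M → ℝ) : Prop :=
  ∃ C : ℝ, ∀ z z' : NatExt M, |A z - A z'| ≤ C * extDist lam z z' ^ θ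

/-- Holonomic probability measures on the natural extension. -/
def IsHolonomic (μ : Measure (NatExt M)) : Prop :=
  IsProbabilityMeasure μ ∧
    ∀ f : C(Shift M, ℝ), ∫ z, f (tau z) ∂μ = ∫ z, f (proj z) ∂μ

/-- The holonomic minimizing value of `A`: the least integral of `A` against a holonomic
probability measure. -/
noncomputable def minValue (A : NatExt M → ℝ) : ℝ :=
  sInf {r : ℝ | ∃ μ : Measure (NatExt M), IsHolonomic μ ∧ r = ∫ z, A z ∂μ}

/-- `u` is a continuous sub-action with respect to `A`. -/
def IsSubAction (A : NatExt M → ℝ) (u : Shift M → ℝ) : Prop :=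
  Continuous u ∧ ∀ z : NatExt M, u (proj z) - u (tau z) ≤ A z - minValue A

/-- `u` is a continuous calibrated sub-action for `A`: moreover, for every `x`, the value `u x` is
the minimum of `u (τ_y x) + A (y, x) - minValue A` over all `y` with `(y, x)` in the natural
extension. -/
def IsCalibrated (A : NatExt M → ℝ) (u : Shift M → ℝ) : Prop :=
  IsSubAction A u ∧
    ∀ x : Shift M,
      IsLeast {r : ℝ | ∃ z : NatExt M, proj z = x ∧ r = u (tau z) + A z - minValue A} (u x)

/-- The paths `(z⁰, …, zᵏ)` of length `k` that begin within `ε` of `x` and end within `ε`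
of `x'`. -/
def Paths (lam ε : ℝ) (x x' : Shift M) (k : ℕ) : Set (Fin (k + 1) → NatExt M) :=
  {z | (∀ i : Fin k, proj (z i.castSucc) = tau (z i.succ)) ∧
    seqDist lam (proj (z 0)).1 x.1 < ε ∧ seqDist lam (proj (z (Fin.last k))).1 x'.1 < ε}

/-- The action `∑_{i = 1}^{k} (A - minValue A) (zⁱ)` of a path. -/
noncomputable def action (A : NatExt M → ℝ) {k : ℕ} (z : Fin (k + 1) → NatExt M) : ℝ :=
  ∑ i : Fin k, (A (z i.succ) - minValue A)

/-- The set `Ω(A)` of non-wandering points with respect to `A`. -/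
def Omega (lam : ℝ) (A : NatExt M → ℝ) : Set (Shift M) :=
  {x | ∀ ε : ℝ, 0 < ε → ∃ k : ℕ, 1 ≤ k ∧ ∃ z ∈ Paths lam ε x x k, |action A z| < ε}

/-- The infimum of the actions of the paths of length `k` from within `ε` of `x` to within `ε`
of `x'`; it is `+∞` if there is no such path. -/
noncomputable def minAction (lam : ℝ) (A : NatExt M → ℝ) (ε : ℝ) (x x' : Shift M) (k : ℕ) :
    EReal :=
  ⨅ z ∈ Paths lam ε x x' k, ((action A z : ℝ) : EReal)

/-- The Peierls barrier `h_A (x, x') = lim_{ε → 0} liminf_{k → ∞} S_A^ε (x, x', k)`. The inner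
quantity is monotone in `ε`, so the limit is a supremum; see `tendsto_peierls`. -/
noncomputable def peierls (lam : ℝ) (A : NatExt M → ℝ) (x x' : Shift M) : EReal :=
  ⨆ (ε : ℝ) (_ : 0 < ε), liminf (fun k : ℕ => minAction lam A ε x x' k) atTop

/-- The Peierls barrier is the limit as `ε` decreases to `0` of the lower limits over `k`. -/
theorem tendsto_peierls (lam : ℝ) (A : NatExt M → ℝ) (x x' : Shift M) :
    Tendsto (fun ε : ℝ => liminf (fun k : ℕ => minAction lam A ε x x' k) atTop) (𝓝[>] 0)
      (𝓝 (peierls lam A x x')) := by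
  have hanti : Antitone (fun ε : ℝ => liminf (fun k : ℕ => minAction lam A ε x x' k) atTop) := by
    intro ε ε' h
    refine liminf_le_liminf (Eventually.of_forall fun k => ?_)
    refine le_iInf₂ fun z hz => iInf₂_le z ?_
    exact ⟨hz.1, hz.2.1.trans_le h, hz.2.2.trans_le h⟩
  have := hanti.tendsto_nhdsGT 0
  rwa [sSup_image] at this

end Holonomic

/-!
A Hölder observable satisfies a Walters condition: a path can be moved together with its end point
at a cost that is small with the displacement, uniformly in the length of the path. Together with
strong connectivity this lets every path be closed up at bounded cost, and the uniform measure on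
the steps of a closed path is holonomic; hence the normalized actions of all paths are bounded
below. Integrating the least action of the paths of length `k` against holonomic measures shows
conversely that for no `k` do all these actions exceed `1`, as `Ā` is the infimum of the holonomic
integrals of `A`. So compactness produces a finite value of the barrier and, by minimization, a
calibrated sub-action.

Iterating the calibration equation backwards from `x` gives an orbit along which the action is the
increment of `u`. Its limit points `w` belong to `Ω(A)`, and `h(w, x) ≤ u(x) - u(w)`, which is
assertion 1. In assertion 2 the values `φ(w) + h(w, x)` form a closed set bounded below, since
`Ω(A)` is compact and the barrier is lower semicontinuous; the calibration of the minimum follows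
by splitting off the last step of the paths that realize the barrier, and `u = φ` on `Ω(A)` because
`h(w, w) ≤ 0` there.
-/

namespace Holonomic

variable {s : ℕ} {M : Matrix (Fin s) (Fin s) ℤ}

section Topology

instance : CompactSpace (Shift M) := by
  refine isCompact_iff_compactSpace.1 (IsClosed.isCompact (s := {x : ℕ → Fin s | _}) ?_)
  simp only [Set.ofPred_forall]
  exact isClosed_iInter fun j => (isClosed_discrete {p : Fin s × Fin s | M p.1 p.2 = 1}).preimage
    (f := fun x : ℕ → Fin s => (x j, x (j + 1))) (by fun_prop)

instance : CompactSpace (DualShift M) := by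
  refine isCompact_iff_compactSpace.1 (IsClosed.isCompact (s := {y : ℕ → Fin s | _}) ?_)
  simp only [Set.ofPred_forall]
  exact isClosed_iInter fun j => (isClosed_discrete {p : Fin s × Fin s | M p.1 p.2 = 1}).preimage
    (f := fun y : ℕ → Fin s => (y (j + 1), y j)) (by fun_prop)

instance : SecondCountableTopology (Shift M) :=
  TopologicalSpace.Subtype.secondCountableTopology {x : ℕ → Fin s | ∀ j, M (x j) (x (j + 1)) = 1}

instance : SecondCountableTopology (DualShift M) :=
  TopologicalSpace.Subtype.secondCountableTopology {y : ℕ → Fin s | ∀ j, M (y (j + 1)) (y j) = 1}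

instance : SecondCountableTopology (NatExt M) :=
  TopologicalSpace.Subtype.secondCountableTopology
    {z : DualShift M × Shift M | M (z.1.1 0) (z.2.1 0) = 1}

instance : CompactSpace (NatExt M) := by
  refine isCompact_iff_compactSpace.1 (IsClosed.isCompact
    (s := {z : DualShift M × Shift M | _}) ?_)
  exact (isClosed_discrete {p : Fin s × Fin s | M p.1 p.2 = 1}).preimage
    (f := fun z : DualShift M × Shift M => (z.1.1 0, z.2.1 0))
    (((continuous_apply 0).comp (by fun_prop)).prodMk ((continuous_apply 0).comp (by fun_prop)))

theorem continuous_proj : Continuous (proj : NatExt M → Shift M) := by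
  unfold proj
  fun_prop

theorem continuous_tau : Continuous (tau : NatExt M → Shift M) := by
  refine Continuous.subtype_mk (continuous_pi fun n => ?_) _
  cases n with
  | zero => exact (continuous_apply 0).comp (f := fun z : NatExt M => z.1.1.1) (by fun_prop)
  | succ n => exact (continuous_apply n).comp (f := fun z : NatExt M => z.1.2.1) (by fun_prop)

theorem eventually_mem_cylinder (x : Shift M) (n : ℕ) :
    ∀ᶠ x' in 𝓝 x, x'.1 ∈ PiNat.cylinder x.1 n :=
  continuous_subtype_val.tendsto x <| (PiNat.isOpen_cylinder _ x.1 n).mem_nhds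
    (PiNat.self_mem_cylinder x.1 n)

theorem tendsto_of_mem_cylinder {ι : Type*} {l : Filter ι} {p p' : ι → Shift M} {k : ι → ℕ}
    {w : Shift M} (hp : Tendsto p l (𝓝 w)) (hk : Tendsto k l atTop)
    (hp' : ∀ i, (p' i).1 ∈ PiNat.cylinder (p i).1 (k i)) : Tendsto p' l (𝓝 w) := by
  refine tendsto_subtype_rng.2 (tendsto_pi_nhds.2 fun j => ?_)
  have hpj := tendsto_pi_nhds.1 (tendsto_subtype_rng.1 hp) j
  refine hpj.congr' ?_
  filter_upwards [hk.eventually_gt_atTop j] with i hi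
  exact (PiNat.mem_cylinder_iff.1 (hp' i) j hi).symm

theorem continuous_of_le_add {ω : ℕ → ℝ} (hω : Tendsto ω atTop (𝓝 0)) {v : Shift M → ℝ}
    (hv : ∀ n, ∀ x x' : Shift M, x'.1 ∈ PiNat.cylinder x.1 (n + 1) → v x' ≤ v x + ω n) :
    Continuous v := by
  refine continuous_iff_continuousAt.2 fun x => Metric.tendsto_nhds.2 fun ε hε => ?_
  obtain ⟨n, hn⟩ := (hω.eventually_lt_const hε).exists
  filter_upwards [eventually_mem_cylinder x (n + 1)] with x' hx'
  have h1 := hv n x x' hx'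
  have h2 := hv n x' x ((PiNat.mem_cylinder_comm _ _ _).1 hx')
  exact abs_lt.2 ⟨by linarith, by linarith⟩

end Topology

section SeqDist

variable {lam : ℝ}

theorem seqDist_self (lam : ℝ) (x : ℕ → Fin s) : seqDist lam x x = 0 := by
  simp [seqDist]

theorem seqDist_nonneg (h0 : 0 < lam) (x x' : ℕ → Fin s) : 0 ≤ seqDist lam x x' := by
  unfold seqDist
  split_ifs <;> positivity

theorem seqDist_le_pow (h0 : 0 < lam) (h1 : lam < 1) {x x' : ℕ → Fin s} {n : ℕ}
    (h : x' ∈ PiNat.cylinder x n) : seqDist lam x' x ≤ lam ^ n := by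
  unfold seqDist
  split_ifs with hxx
  · positivity
  · have hne : {j | x' j ≠ x j}.Nonempty := Function.ne_iff.1 hxx
    refine pow_le_pow_of_le_one h0.le h1.le (not_lt.1 fun hlt => ?_)
    exact Nat.sInf_mem hne (PiNat.mem_cylinder_iff.1 h _ hlt)

theorem mem_cylinder_of_seqDist_lt (h0 : 0 < lam) (h1 : lam < 1) {x x' : ℕ → Fin s} {n : ℕ}
    (h : seqDist lam x' x < lam ^ n) : x' ∈ PiNat.cylinder x n := by
  refine PiNat.mem_cylinder_iff.2 fun j hj => by_contra fun hne => h.not_ge ?_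
  rw [seqDist, if_neg fun e => hne (congrFun e j)]
  exact pow_le_pow_of_le_one h0.le h1.le ((Nat.sInf_le hne).trans hj.le)

theorem hasBasis_nhds_seqDist (h0 : 0 < lam) (h1 : lam < 1) (x : ℕ → Fin s) :
    (𝓝 x).HasBasis (fun ε : ℝ => 0 < ε) (fun ε => {x' | seqDist lam x' x < ε}) := by
  refine ⟨fun t => ⟨fun ht => ?_, fun ⟨ε, hε, hsub⟩ => ?_⟩⟩
  · obtain ⟨_, ⟨y, n, rfl⟩, hx, hsub⟩ :=
      (PiNat.isTopologicalBasis_cylinders (fun _ : ℕ => Fin s)).mem_nhds_iff.1 ht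
    rw [← PiNat.mem_cylinder_iff_eq.1 hx] at hsub
    exact ⟨lam ^ n, by positivity, fun x' hx' => hsub (mem_cylinder_of_seqDist_lt h0 h1 hx')⟩
  · obtain ⟨n, hn⟩ := exists_pow_lt_of_lt_one hε h1
    filter_upwards [(PiNat.isOpen_cylinder _ x n).mem_nhds (PiNat.self_mem_cylinder x n)]
      with x' hx'
    exact hsub ((seqDist_le_pow h0 h1 hx').trans_lt hn)

theorem hasBasis_nhds_endpoints_action (h0 : 0 < lam) (h1 : lam < 1) (w x : Shift M) (c : ℝ) :
    (𝓝 (w, x, c)).HasBasis (fun ε : ℝ => 0 < ε) fun ε =>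
      {t | seqDist lam t.1.1 w.1 < ε ∧ seqDist lam t.2.1.1 x.1 < ε ∧ |t.2.2 - c| < ε} := by
  have hshift (y : Shift M) : (𝓝 y).HasBasis (fun ε : ℝ => 0 < ε)
      (fun ε => {y' | seqDist lam y'.1 y.1 < ε}) := by
    rw [nhds_subtype_eq_comap]
    exact (hasBasis_nhds_seqDist h0 h1 y.1).comap _
  have hmin {i j : ℝ} (hi : 0 < i) (hj : 0 < j) : ∃ k, 0 < k ∧ k ≤ i ∧ k ≤ j :=
    ⟨min i j, lt_min hi hj, min_le_left i j, min_le_right i j⟩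
  rw [nhds_prod_eq, nhds_prod_eq]
  refine (hshift w).prod_same_index ((hshift x).prod_same_index Metric.nhds_basis_ball ?_) ?_
  · intro i j hi hj
    obtain ⟨k, hk, hki, hkj⟩ := hmin hi hj
    exact ⟨k, hk, fun _ h => lt_of_lt_of_le h hki, Metric.ball_subset_ball hkj⟩
  · intro i j hi hj
    obtain ⟨k, hk, hki, hkj⟩ := hmin hi hj
    exact ⟨k, hk, fun _ h => lt_of_lt_of_le h hki,
      Set.prod_mono (fun _ h => lt_of_lt_of_le h hkj) (Metric.ball_subset_ball hkj)⟩

end SeqDist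

section Edges

/-- The graph of the allowed transitions `a → b`, those with `M a b = 1`, is strongly connected,
with a path of positive length from each letter to itself. -/
def StronglyConnected (M : Matrix (Fin s) (Fin s) ℤ) : Prop :=
  ∀ i j, Relation.TransGen (fun a b => M a b = 1) i j

theorem stronglyConnected_of_isIrreducible (hM01 : ∀ i j, M i j = 0 ∨ M i j = 1)
    (hM : M.IsIrreducible) : StronglyConnected M := by
  let : Quiver (Fin s) := M.toQuiver
  have hedge {a b : Fin s} (e : a ⟶ b) : M a b = 1 := (hM01 a b).resolve_left (ne_of_gt e.down)
  have htrans {a b : Fin s} (p : Quiver.Path a b) :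
      p.length = 0 ∨ Relation.TransGen (fun a b => M a b = 1) a b := by
    induction p with
    | nil => exact .inl rfl
    | cons p e ih =>
      rcases ih with h | h
      · obtain rfl := Quiver.Path.eq_of_length_zero p h
        exact .inr (.single (hedge e))
      · exact .inr (h.tail (hedge e))
  intro i j
  obtain ⟨p, hp⟩ := hM.connected i j
  exact (htrans p).resolve_left hp.ne'

theorem StronglyConnected.exists_predecessor (hM : StronglyConnected M) (j : Fin s) :
    ∃ i, M i j = 1 := by
  obtain ⟨i, -, hi⟩ := Relation.TransGen.tail'_iff.1 (hM j j)
  exact ⟨i, hi⟩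

theorem StronglyConnected.exists_tau_apply_zero (hM : StronglyConnected M) (x : Shift M)
    {i : Fin s} (hi : M i (x.1 0) = 1) : ∃ z : NatExt M, proj z = x ∧ (tau z).1 0 = i := by
  choose pred hpred using hM.exists_predecessor
  refine ⟨⟨(⟨fun n => pred^[n] i, fun j => ?_⟩, x), hi⟩, rfl, rfl⟩
  change M (pred^[j + 1] i) (pred^[j] i) = 1
  rw [Function.iterate_succ_apply']
  exact hpred _

theorem StronglyConnected.proj_surjective (hM : StronglyConnected M) :
    Function.Surjective (proj : NatExt M → Shift M) := fun x =>
  let ⟨_, hi⟩ := hM.exists_predecessor (x.1 0)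
  (hM.exists_tau_apply_zero x hi).imp fun _ h => h.1

end Edges

section Chain

/-- The paper's `A - Ā`, the observable shifted so that its holonomic minimizing value is zero. -/
noncomputable def normalized (A : NatExt M → ℝ) (z : NatExt M) : ℝ := A z - minValue A

/-- `Chain g k p q a`: some path of `k` steps leads from `p` to `q` and the sum of `g` along it
is `a`. A step from `τ_y x` to `x` contributes `g (y, x)`, so that, unlike in `Paths`, no past has
to be chosen at the first point. -/
inductive Chain (g : NatExt M → ℝ) : ℕ → Shift M → Shift M → ℝ → Prop
  | nil (p : Shift M) : Chain g 0 p p 0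
  | snoc {k : ℕ} {p : Shift M} {a : ℝ} (z : NatExt M) (h : Chain g k p (tau z) a) :
      Chain g (k + 1) p (proj z) (a + g z)

namespace Chain

variable {g : NatExt M → ℝ} {k l : ℕ} {p q r : Shift M} {a b : ℝ}

theorem single (g : NatExt M → ℝ) (z : NatExt M) : Chain g 1 (tau z) (proj z) (g z) := by
  simpa using Chain.snoc z (Chain.nil (g := g) (tau z))

theorem exists_snoc (h : Chain g (k + 1) p q a) :
    ∃ z, proj z = q ∧ Chain g k p (tau z) (a - g z) := by
  cases h with
  | snoc z h => exact ⟨z, rfl, by rwa [add_sub_cancel_right]⟩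

theorem trans (h : Chain g k p q a) (h' : Chain g l q r b) : Chain g (k + l) p r (a + b) := by
  induction h' with
  | nil => simpa using h
  | snoc z _ ih => exact add_assoc a _ _ ▸ (ih h).snoc z

theorem iterate (h : Chain g k p p a) (n : ℕ) : Chain g (n * k) p p (n * a) := by
  induction n with
  | zero => simpa using Chain.nil p
  | succ n ih => simpa [add_mul] using ih.trans h

theorem add_const (h : Chain g k p q a) (c : ℝ) :
    Chain (fun z => g z + c) k p q (a + k * c) := by
  induction h with
  | nil p => simpa using Chain.nil p
  | snoc z _ ih =>
    convert ih.snoc z using 1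
    push_cast
    ring

theorem apply_eq (h : Chain g k p q a) (j : ℕ) : p.1 (k + j) = q.1 j := by
  induction h generalizing j with
  | nil => rw [zero_add]
  | @snoc k _ _ z _ ih => exact (congrArg _ (by ring)).trans (ih (j + 1))

end Chain

theorem chain_of_path {A : NatExt M → ℝ} {k : ℕ} (z : Fin (k + 1) → NatExt M)
    (hz : ∀ i : Fin k, proj (z i.castSucc) = tau (z i.succ)) :
    Chain (normalized A) k (proj (z 0)) (proj (z (Fin.last k))) (action A z) := by
  induction k with
  | zero => simpa [action] using Chain.nil (proj (z 0))
  | succ k ih =>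
    have hinit := ih (fun i => z i.castSucc) fun i => hz i.castSucc
    rw [hz (Fin.last k)] at hinit
    have haction : action A z =
        action A (fun i => z i.castSucc) + normalized A (z (Fin.last k).succ) :=
      Fin.sum_univ_castSucc _
    exact haction ▸ hinit.snoc _

theorem Chain.exists_path {A : NatExt M → ℝ} (hπ : Function.Surjective (proj : NatExt M → Shift M))
    {k : ℕ} {p q : Shift M} {a : ℝ} (h : Chain (normalized A) k p q a) :
    ∃ z : Fin (k + 1) → NatExt M, (∀ i : Fin k, proj (z i.castSucc) = tau (z i.succ)) ∧
      proj (z 0) = p ∧ proj (z (Fin.last k)) = q ∧ action A z = a := by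
  induction h with
  | nil p =>
    obtain ⟨z, hz⟩ := hπ p
    exact ⟨fun _ => z, fun i => i.elim0, hz, hz, by simp [action]⟩
  | @snoc k p a w _ ih =>
    obtain ⟨z, hz, hfirst, hlast, ha⟩ := ih
    refine ⟨Fin.snoc (α := fun _ => NatExt M) z w, fun i => ?_, ?_, ?_, ?_⟩
    · refine Fin.lastCases ?_ (fun i => ?_) i
      · rw [Fin.succ_last, Fin.snoc_last, Fin.snoc_castSucc, hlast]
      · rw [Fin.snoc_castSucc, Fin.succ_castSucc, Fin.snoc_castSucc, hz i]
    · rw [← Fin.castSucc_zero, Fin.snoc_castSucc, hfirst]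
    · rw [Fin.snoc_last]
    · simp only [action, Fin.sum_univ_castSucc, Fin.succ_castSucc, Fin.succ_last, Fin.snoc_castSucc,
        Fin.snoc_last]
      exact congrArg (· + normalized A w) ha

end Chain

section Walters

variable {lam θ C : ℝ} {g : NatExt M → ℝ} {ω : ℕ → ℝ}

/-- `g` is continuous and satisfies a Walters-type condition of uniformly small distortion: moving
the end point of a path inside a cylinder of length `n + 1` and keeping its steps changes the sum of
`g` along it by at most `ω n → 0`, whatever the length of the path. It is all that the theory needs
of a Hölder observable. -/
structure IsWalters (g : NatExt M → ℝ) (ω : ℕ → ℝ) : Prop where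
  continuous : Continuous g
  tendsto_zero : Tendsto ω atTop (𝓝 0)
  exists_chain : ∀ ⦃k p q a⦄, Chain g k p q a → ∀ n (q' : Shift M),
    q'.1 ∈ PiNat.cylinder q.1 (n + 1) →
      ∃ p' a', Chain g k p' q' a' ∧ p'.1 ∈ PiNat.cylinder p.1 k ∧ |a' - a| ≤ ω n

protected theorem IsWalters.normalized {A : NatExt M → ℝ} (hA : IsWalters A ω) :
    IsWalters (normalized A) ω where
  continuous := hA.continuous.sub continuous_const
  tendsto_zero := hA.tendsto_zero
  exists_chain := by
    intro k p q a h n q' hq'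
    have hA' : Chain A k p q (a + k * minValue A) := by
      simpa [Holonomic.normalized] using h.add_const (minValue A)
    obtain ⟨p', a', hchain, hp', ha'⟩ := hA.exists_chain hA' n q' hq'
    refine ⟨p', a' + k * -minValue A, hchain.add_const _, hp', ?_⟩
    rwa [show a' + k * -minValue A - a = a' - (a + k * minValue A) by ring]

/-- The point of the natural extension with the past of `z` and the future `x`. -/
def withFuture (z : NatExt M) (x : Shift M) (h : x.1 0 = (proj z).1 0) : NatExt M :=
  ⟨(z.1.1, x), (congrArg (M (z.1.1.1 0)) h).trans z.2⟩

theorem extDist_withFuture_le (h0 : 0 < lam) (h1 : lam < 1) (z : NatExt M) {x : Shift M}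
    (h : x.1 0 = (proj z).1 0) {n : ℕ} (hx : x.1 ∈ PiNat.cylinder (proj z).1 n) :
    extDist lam (withFuture z x h) z ≤ lam ^ n :=
  max_le ((seqDist_self lam z.1.1.1).trans_le (by positivity)) (seqDist_le_pow h0 h1 hx)

theorem tau_withFuture_mem_cylinder (z : NatExt M) {x : Shift M} (h : x.1 0 = (proj z).1 0) {n : ℕ}
    (hx : x.1 ∈ PiNat.cylinder (proj z).1 n) :
    (tau (withFuture z x h)).1 ∈ PiNat.cylinder (tau z).1 (n + 1) := by
  refine PiNat.mem_cylinder_iff.2 fun j hj => ?_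
  cases j with
  | zero => rfl
  | succ j => exact PiNat.mem_cylinder_iff.1 hx j (by omega)

theorem extDist_nonneg (h0 : 0 < lam) (z z' : NatExt M) : 0 ≤ extDist lam z z' :=
  le_max_of_le_left (seqDist_nonneg h0 _ _)

theorem IsHolder.exists_nonneg (h0 : 0 < lam) (hg : IsHolder lam θ g) :
    ∃ C, 0 ≤ C ∧ ∀ z z', |g z - g z'| ≤ C * extDist lam z z' ^ θ := by
  obtain ⟨C, hC⟩ := hg
  refine ⟨max C 0, le_max_right _ _, fun z z' => (hC z z').trans ?_⟩
  exact mul_le_mul_of_nonneg_right (le_max_left _ _) (Real.rpow_nonneg (extDist_nonneg h0 z z') θ)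

theorem continuous_of_abs_sub_le_extDist (h0 : 0 < lam) (h1 : lam < 1) (hθ : 0 < θ)
    (hg : ∀ z z', |g z - g z'| ≤ C * extDist lam z z' ^ θ) : Continuous g := by
  refine continuous_iff_continuousAt.2 fun z => tendsto_iff_dist_tendsto_zero.2 ?_
  have hdist {f : NatExt M → ℕ → Fin s} (hf : Continuous f) :
      Tendsto (fun z' => seqDist lam (f z') (f z)) (𝓝 z) (𝓝 0) := by
    refine Metric.tendsto_nhds.2 fun ε hε => ?_
    filter_upwards [hf.tendsto z ((hasBasis_nhds_seqDist h0 h1 _).mem_of_mem hε)] with z' hz'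
    rwa [Real.dist_0_eq_abs, abs_of_nonneg (seqDist_nonneg h0 _ _)]
  have hext : Tendsto (fun z' => extDist lam z' z) (𝓝 z) (𝓝 0) := by
    simpa [extDist] using (hdist (f := fun z => z.1.1.1) (by fun_prop)).max
      (hdist (f := fun z => z.1.2.1) (by fun_prop))
  have hpow : Tendsto (fun z' => C * extDist lam z' z ^ θ) (𝓝 z) (𝓝 0) := by
    simpa [Real.zero_rpow hθ.ne'] using (hext.rpow_const (.inr hθ.le)).const_mul C
  exact squeeze_zero (fun _ => dist_nonneg) (fun z' => hg z' z) hpow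

theorem exists_chain_of_abs_sub_le_extDist (h0 : 0 < lam) (h1 : lam < 1) (hθ : 0 < θ) (hC : 0 ≤ C)
    (hg : ∀ z z', |g z - g z'| ≤ C * extDist lam z z' ^ θ) {k : ℕ} {p q : Shift M} {a : ℝ}
    (h : Chain g k p q a) {n : ℕ} {q' : Shift M} (hq' : q'.1 ∈ PiNat.cylinder q.1 (n + 1)) :
    ∃ p' a', Chain g k p' q' a' ∧ p'.1 ∈ PiNat.cylinder p.1 (k + n + 1) ∧
      |a' - a| ≤ C / (1 - lam ^ θ) * (lam ^ θ) ^ (n + 1) := by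
  have hlt : lam ^ θ < 1 := Real.rpow_lt_one h0.le h1 hθ
  have hne : 1 - lam ^ θ ≠ 0 := (sub_pos.2 hlt).ne'
  induction h generalizing n q' with
  | nil p =>
    refine ⟨q', 0, .nil q', by rwa [zero_add], ?_⟩
    have := div_nonneg hC (sub_pos.2 hlt).le
    rw [sub_self, abs_zero]
    positivity
  | @snoc k p a z _ ih =>
    have hfst : q'.1 0 = (proj z).1 0 := PiNat.mem_cylinder_iff.1 hq' 0 n.succ_pos
    set z' := withFuture z q' hfst
    obtain ⟨p', a', hchain, hp', ha'⟩ := ih (tau_withFuture_mem_cylinder z hfst hq')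
    refine ⟨p', a' + g z', hchain.snoc z', by convert hp' using 2; ring, ?_⟩
    have hstep : |g z' - g z| ≤ C * (lam ^ θ) ^ (n + 1) := by
      rw [Real.rpow_pow_comm h0.le]
      refine (hg z' z).trans (mul_le_mul_of_nonneg_left ?_ hC)
      exact Real.rpow_le_rpow (extDist_nonneg h0 _ _) (extDist_withFuture_le h0 h1 z hfst hq') hθ.le
    calc |a' + g z' - (a + g z)| ≤ |a' - a| + |g z' - g z| := by
          rw [add_sub_add_comm]
          exact abs_add_le _ _
      _ ≤ C / (1 - lam ^ θ) * (lam ^ θ) ^ (n + 1 + 1) + C * (lam ^ θ) ^ (n + 1) :=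
          add_le_add ha' hstep
      _ = C / (1 - lam ^ θ) * (lam ^ θ) ^ (n + 1) := by
          field_simp
          ring

theorem IsHolder.exists_isWalters (h0 : 0 < lam) (h1 : lam < 1) (hθ : 0 < θ)
    (hg : IsHolder lam θ g) : ∃ ω, IsWalters g ω := by
  obtain ⟨C, hC, hgC⟩ := hg.exists_nonneg h0
  refine ⟨fun n => C / (1 - lam ^ θ) * (lam ^ θ) ^ (n + 1),
    continuous_of_abs_sub_le_extDist h0 h1 hθ hgC, ?_, fun k p q a h n q' hq' => ?_⟩
  · simpa using ((tendsto_pow_atTop_nhds_zero_of_lt_one (Real.rpow_nonneg h0.le θ)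
      (Real.rpow_lt_one h0.le h1 hθ)).comp (tendsto_add_atTop_nat 1)).const_mul (C / (1 - lam ^ θ))
  · obtain ⟨p', a', hchain, hp', ha'⟩ :=
      exists_chain_of_abs_sub_le_extDist h0 h1 hθ hC hgC h hq'
    exact ⟨p', a', hchain, PiNat.cylinder_anti _ (by omega) hp', ha'⟩

end Walters

section Barrier

/-- `Reaches g w x c`: the Peierls barrier of `g` from `w` to `x` is at most `c`, in the form that
`(w, x, c)` is a limit of points `(p, q, b)` such that an arbitrarily long path leads from `p` to
`q` with action at most `b`; see `peierls_le_coe_iff`. -/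
def Reaches (g : NatExt M → ℝ) (w x : Shift M) (c : ℝ) : Prop :=
  ∀ N : ℕ, (w, x, c) ∈ closure
    {t : Shift M × Shift M × ℝ | ∃ k ≥ N, ∃ a ≤ t.2.2, Chain g k t.1 t.2.1 a}

variable {g : NatExt M → ℝ} {w x : Shift M} {c : ℝ}

theorem isClosed_setOf_reaches (g : NatExt M → ℝ) :
    IsClosed {t : Shift M × Shift M × ℝ | Reaches g t.1 t.2.1 t.2.2} := by
  simp only [Reaches, Set.ofPred_forall]
  exact isClosed_iInter fun _ => isClosed_closure

theorem reaches_of_tendsto {k : ℕ → ℕ} {p q : ℕ → Shift M} {a b : ℕ → ℝ}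
    (hk : Tendsto k atTop atTop) (hp : Tendsto p atTop (𝓝 w)) (hq : Tendsto q atTop (𝓝 x))
    (hb : Tendsto b atTop (𝓝 c)) (hab : ∀ n, a n ≤ b n)
    (h : ∀ n, Chain g (k n) (p n) (q n) (a n)) : Reaches g w x c := fun N =>
  mem_closure_of_tendsto (hp.prodMk_nhds (hq.prodMk_nhds hb)) <|
    (hk.eventually_ge_atTop N).mono fun n hn => ⟨k n, hn, a n, hab n, h n⟩

theorem Reaches.exists_seq (h : Reaches g w x c) :
    ∃ (k : ℕ → ℕ) (p q : ℕ → Shift M) (a b : ℕ → ℝ), (∀ n, n ≤ k n) ∧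
      Tendsto p atTop (𝓝 w) ∧ Tendsto q atTop (𝓝 x) ∧ Tendsto b atTop (𝓝 c) ∧
      (∀ n, a n ≤ b n) ∧ ∀ n, Chain g (k n) (p n) (q n) (a n) := by
  obtain ⟨U, hU⟩ := (𝓝 (w, x, c)).exists_antitone_basis
  have hmeet (N : ℕ) := mem_closure_iff_nhds.1 (h N) (U N) (hU.mem N)
  choose t htU k hk a ha hchain using hmeet
  have ht : Tendsto t atTop (𝓝 (w, x, c)) := hU.tendsto htU
  rw [nhds_prod_eq, nhds_prod_eq] at ht
  exact ⟨k, fun n => (t n).1, fun n => (t n).2.1, a, fun n => (t n).2.2,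
    hk, ht.fst, ht.snd.fst, ht.snd.snd, ha, hchain⟩

variable {lam : ℝ} {A : NatExt M → ℝ}

theorem reaches_iff_frequently (h0 : 0 < lam) (h1 : lam < 1) :
    Reaches g w x c ↔ ∀ ε : ℝ, 0 < ε → ∃ᶠ k in atTop, ∃ p q a, Chain g k p q a ∧
      seqDist lam p.1 w.1 < ε ∧ seqDist lam q.1 x.1 < ε ∧ a < c + ε := by
  simp only [Reaches, mem_closure_iff_nhds_basis (hasBasis_nhds_endpoints_action h0 h1 w x c),
    frequently_atTop]
  constructor
  · intro h ε hε N
    obtain ⟨⟨p, q, b⟩, ⟨k, hk, a, ha, hchain⟩, hp, hq, hb⟩ := h N ε hε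
    exact ⟨k, hk, p, q, a, hchain, hp, hq, by linarith [(abs_lt.1 hb).2]⟩
  · intro h N ε hε
    obtain ⟨k, hk, p, q, a, hchain, hp, hq, ha⟩ := h ε hε N
    refine ⟨(p, q, max a c), ⟨k, hk, a, le_max_left a c, hchain⟩, hp, hq, ?_⟩
    rw [abs_of_nonneg (sub_nonneg.2 (le_max_right a c)), sub_lt_iff_lt_add']
    exact max_lt ha (lt_add_of_pos_right c hε)

theorem minAction_lt_iff (hπ : Function.Surjective (proj : NatExt M → Shift M)) {ε : ℝ} {k : ℕ}
    {y : EReal} : minAction lam A ε w x k < y ↔ ∃ p q a, Chain (normalized A) k p q a ∧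
      seqDist lam p.1 w.1 < ε ∧ seqDist lam q.1 x.1 < ε ∧ (a : EReal) < y := by
  simp only [minAction, iInf_lt_iff]
  constructor
  · rintro ⟨z, ⟨hz, hfirst, hlast⟩, hy⟩
    exact ⟨_, _, _, chain_of_path z hz, hfirst, hlast, hy⟩
  · rintro ⟨p, q, a, h, hp, hq, hy⟩
    obtain ⟨z, hz, rfl, rfl, rfl⟩ := h.exists_path hπ
    exact ⟨z, ⟨hz, hp, hq⟩, hy⟩

theorem peierls_le_coe_iff (hπ : Function.Surjective (proj : NatExt M → Shift M)) (h0 : 0 < lam)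
    (h1 : lam < 1) : peierls lam A w x ≤ c ↔ Reaches (normalized A) w x c := by
  have hliminf (ε : ℝ) : liminf (minAction lam A ε w x) atTop ≤ c ↔ ∀ y > (c : EReal),
      ∃ᶠ k in atTop, ∃ p q a, Chain (normalized A) k p q a ∧
        seqDist lam p.1 w.1 < ε ∧ seqDist lam q.1 x.1 < ε ∧ (a : EReal) < y := by
    simp only [← minAction_lt_iff hπ]
    exact liminf_le_iff
  simp only [reaches_iff_frequently h0 h1, peierls, iSup_le_iff, hliminf]
  constructor
  · intro h ε hε
    exact_mod_cast h ε hε _ (EReal.coe_lt_coe_iff.2 (lt_add_of_pos_right c hε))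
  · intro h ε hε y hy
    obtain ⟨b, hcb, hby⟩ := EReal.lt_iff_exists_real_btwn.1 hy
    have hδ : 0 < min ε (b - c) := lt_min hε (sub_pos.2 (EReal.coe_lt_coe_iff.1 hcb))
    refine (h _ hδ).mono fun k ⟨p, q, a, hchain, hp, hq, ha⟩ => ⟨p, q, a, hchain,
      hp.trans_le (min_le_left _ _), hq.trans_le (min_le_left _ _), hby.trans' ?_⟩
    have := min_le_right ε (b - c)
    exact EReal.coe_lt_coe_iff.2 (by linarith)

theorem mem_Omega_iff (hπ : Function.Surjective (proj : NatExt M → Shift M)) (h0 : 0 < lam)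
    (h1 : lam < 1) : w ∈ Omega lam A ↔ (w, w, (0 : ℝ)) ∈ closure
      {t : Shift M × Shift M × ℝ | ∃ k ≥ 1, Chain (normalized A) k t.1 t.2.1 t.2.2} := by
  simp only [mem_closure_iff_nhds_basis (hasBasis_nhds_endpoints_action h0 h1 w w 0), sub_zero]
  refine forall₂_congr fun ε _ => ⟨?_, ?_⟩
  · rintro ⟨k, hk, z, ⟨hz, hfirst, hlast⟩, ha⟩
    exact ⟨(_, _, _), ⟨k, hk, chain_of_path z hz⟩, hfirst, hlast, ha⟩
  · rintro ⟨⟨p, q, a⟩, ⟨k, hk, hchain⟩, hp, hq, ha⟩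
    obtain ⟨z, hz, rfl, rfl, rfl⟩ := hchain.exists_path hπ
    exact ⟨k, hk, z, ⟨hz, hp, hq⟩, ha⟩

theorem coe_add_le_coe_iff (r y : ℝ) (h : EReal) :
    (r : EReal) + h ≤ y ↔ h ≤ ((y - r : ℝ) : EReal) := by
  rw [EReal.coe_sub, EReal.le_sub_iff_add_le (.inl (EReal.coe_ne_bot r))
    (.inl (EReal.coe_ne_top r)), add_comm]

theorem isLeast_range_add_peierls (hπ : Function.Surjective (proj : NatExt M → Shift M))
    (h0 : 0 < lam) (h1 : lam < 1) {ι : Type*} {w : ι → Shift M} {φ : ι → ℝ} {r : ℝ}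
    (hr : IsLeast {r | ∃ i, Reaches (normalized A) (w i) x (r - φ i)} r) :
    IsLeast (Set.range fun i => (φ i : EReal) + peierls lam A (w i) x) r := by
  have hle (i : ι) (y : ℝ) : (φ i : EReal) + peierls lam A (w i) x ≤ y ↔
      Reaches (normalized A) (w i) x (y - φ i) := by
    rw [coe_add_le_coe_iff, peierls_le_coe_iff hπ h0 h1]
  have hlower (i : ι) : (r : EReal) ≤ φ i + peierls lam A (w i) x :=
    EReal.le_of_forall_lt_iff_le.1 fun y hy =>
      EReal.coe_le_coe_iff.2 (hr.2 ⟨i, (hle i y).1 hy.le⟩)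
  obtain ⟨i, hi⟩ := hr.1
  exact ⟨⟨i, ((hle i r).2 hi).antisymm (hlower i)⟩, Set.forall_mem_range.2 hlower⟩

end Barrier

section Calibrated

variable {lam : ℝ} {A : NatExt M → ℝ} {u : Shift M → ℝ}

theorem Chain.sub_le (hu : IsSubAction A u) {k : ℕ} {p q : Shift M} {a : ℝ}
    (h : Chain (normalized A) k p q a) : u q - u p ≤ a := by
  induction h with
  | nil p => rw [sub_self]
  | snoc z _ ih =>
    have hstep : u (proj z) - u (tau z) ≤ normalized A z := hu.2 z
    linarith

theorem Reaches.sub_le (hu : IsSubAction A u) {w x : Shift M} {c : ℝ}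
    (h : Reaches (normalized A) w x c) : u x - u w ≤ c := by
  have hclosed : IsClosed {t : Shift M × Shift M × ℝ | u t.2.1 - u t.1 ≤ t.2.2} := by
    have := hu.1
    exact isClosed_le (by fun_prop) (by fun_prop)
  refine closure_minimal ?_ hclosed (h 0)
  rintro t ⟨_, _, _, ha, hchain⟩
  exact (hchain.sub_le hu).trans ha

namespace IsCalibrated

theorem proj_surjective (hu : IsCalibrated A u) :
    Function.Surjective (proj : NatExt M → Shift M) := fun x =>
  let ⟨z, hz, _⟩ := (hu.2 x).1
  ⟨z, hz⟩

theorem exists_backward_orbit (hu : IsCalibrated A u) (x : Shift M) :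
    ∃ o : ℕ → Shift M, o 0 = x ∧
      ∀ m n, Chain (normalized A) n (o (m + n)) (o m) (u (o m) - u (o (m + n))) := by
  choose ζ hζ huζ using fun x => (hu.2 x).1
  set o : ℕ → Shift M := fun n => (fun x => tau (ζ x))^[n] x
  have hstep (n : ℕ) : Chain (normalized A) 1 (o (n + 1)) (o n) (u (o n) - u (o (n + 1))) := by
    have hsucc : o (n + 1) = tau (ζ (o n)) := Function.iterate_succ_apply' _ _ _
    have haction : u (o n) - u (tau (ζ (o n))) = normalized A (ζ (o n)) := by
      rw [huζ (o n), normalized]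
      ring
    simpa only [hsucc, haction, hζ] using Chain.single (normalized A) (ζ (o n))
  refine ⟨o, rfl, fun m n => ?_⟩
  induction n with
  | zero => simpa using Chain.nil (o m)
  | succ n ih =>
    have hchain := (hstep (m + n)).trans ih
    rwa [sub_add_sub_cancel', add_comm 1 n] at hchain

theorem exists_reaches (hu : IsCalibrated A u) (h0 : 0 < lam) (h1 : lam < 1) (x : Shift M) :
    ∃ w ∈ Omega lam A, Reaches (normalized A) w x (u x - u w) := by
  obtain ⟨o, rfl, hchain⟩ := hu.exists_backward_orbit x
  obtain ⟨w, φ, hφ, how⟩ := CompactSpace.tendsto_subseq o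
  have how_succ : Tendsto (fun n => o (φ (n + 1))) atTop (𝓝 w) :=
    how.comp (tendsto_add_atTop_nat 1)
  have hu_tendsto {p : ℕ → Shift M} (hp : Tendsto p atTop (𝓝 w)) :
      Tendsto (fun n => u (p n)) atTop (𝓝 (u w)) := (hu.1.1.tendsto w).comp hp
  refine ⟨w, (mem_Omega_iff hu.proj_surjective h0 h1).2 ?_, ?_⟩
  · have haction : Tendsto (fun n => u (o (φ n)) - u (o (φ (n + 1)))) atTop (𝓝 0) := by
      simpa using (hu_tendsto how).sub (hu_tendsto how_succ)
    refine mem_closure_of_tendsto (how_succ.prodMk_nhds (how.prodMk_nhds haction))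
      (.of_forall fun n => ?_)
    have hlt : φ n < φ (n + 1) := hφ n.lt_succ_self
    refine ⟨φ (n + 1) - φ n, Nat.sub_pos_of_lt hlt, ?_⟩
    simpa [Nat.add_sub_cancel' hlt.le] using hchain (φ n) (φ (n + 1) - φ n)
  · refine reaches_of_tendsto hφ.tendsto_atTop how tendsto_const_nhds
      ((hu_tendsto how).const_sub (u (o 0))) (fun _ => le_rfl) fun n => ?_
    simpa using hchain 0 (φ n)

theorem isLeast (hu : IsCalibrated A u) (h0 : 0 < lam) (h1 : lam < 1) (x : Shift M) :
    IsLeast (Set.range fun w : Omega lam A => (u w : EReal) + peierls lam A w x) (u x) := by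
  refine isLeast_range_add_peierls hu.proj_surjective h0 h1 ⟨?_, fun r ⟨w, hr⟩ => ?_⟩
  · obtain ⟨w, hw, hreach⟩ := hu.exists_reaches h0 h1 x
    exact ⟨⟨w, hw⟩, hreach⟩
  · linarith [hr.sub_le hu.1]

end IsCalibrated

end Calibrated

section ClosedChains

variable {g : NatExt M → ℝ} {ω : ℕ → ℝ}

theorem exists_abs_le (hg : Continuous g) : ∃ G, ∀ z, |g z| ≤ G := by
  obtain ⟨G, hG⟩ := (isCompact_range hg).isBounded.exists_norm_le
  exact ⟨G, fun z => hG _ ⟨z, rfl⟩⟩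

theorem StronglyConnected.exists_connection (hM : StronglyConnected M) (hg : Continuous g) :
    ∃ D, ∀ (i : Fin s) (r : Shift M), ∃ n ≥ 1, ∃ p, ∃ b ≤ D, Chain g n p r b ∧ p.1 0 = i := by
  obtain ⟨G, hG⟩ := exists_abs_le hg
  have hedge (i : Fin s) (r : Shift M) (hi : M i (r.1 0) = 1) :
      ∃ p, ∃ b ≤ G, Chain g 1 p r b ∧ p.1 0 = i := by
    obtain ⟨z, rfl, hz⟩ := hM.exists_tau_apply_zero r hi
    exact ⟨tau z, g z, (le_abs_self _).trans (hG z), .single g z, hz⟩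
  have hletters (i j : Fin s) : ∃ D, ∀ r : Shift M, r.1 0 = j →
      ∃ n ≥ 1, ∃ p, ∃ b ≤ D, Chain g n p r b ∧ p.1 0 = i := by
    induction hM i j using Relation.TransGen.head_induction_on with
    | single h => exact ⟨G, fun r hr => ⟨1, le_rfl, hedge _ r (hr ▸ h)⟩⟩
    | head h _ ih =>
      obtain ⟨D, hD⟩ := ih
      refine ⟨G + D, fun r hr => ?_⟩
      obtain ⟨n, -, p, b, hb, hchain, hp⟩ := hD r hr
      obtain ⟨p', b', hb', hchain', hp'⟩ := hedge _ p (hp ▸ h)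
      exact ⟨1 + n, by omega, p', b' + b, add_le_add hb' hb, hchain'.trans hchain, hp'⟩
  choose D hD using hletters
  obtain ⟨B, hB⟩ := (Set.finite_range fun ij : Fin s × Fin s => D ij.1 ij.2).bddAbove
  refine ⟨B, fun i r => ?_⟩
  obtain ⟨n, hn, p, b, hb, hchain, hp⟩ := hD i (r.1 0) r rfl
  exact ⟨n, hn, p, b, hb.trans (hB ⟨(i, r.1 0), rfl⟩), hchain, hp⟩

theorem exists_periodic (p : Shift M) {n : ℕ} (hp : p.1 n = p.1 0) :
    ∃ r : Shift M, ∀ j, r.1 j = p.1 (j % n) := by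
  refine ⟨⟨fun j => p.1 (j % n), fun j => ?_⟩, fun _ => rfl⟩
  have hsucc : p.1 ((j + 1) % n) = p.1 (j % n + 1) := by
    rw [← Nat.mod_add_mod]
    rcases eq_or_ne (j % n + 1) n with h | h
    · rw [h, Nat.mod_self, hp]
    · rcases Nat.eq_zero_or_pos n with rfl | hn
      · rw [Nat.mod_zero]
      · rw [Nat.mod_eq_of_lt (lt_of_le_of_ne (Nat.mod_lt j hn) h)]
  exact (congrArg (M (p.1 (j % n))) hsucc).trans (p.2 (j % n))

theorem IsWalters.exists_closed_chain (hg : IsWalters g ω) {k : ℕ} {p q : Shift M} {a : ℝ}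
    (h : Chain g k p q a) (hpq : p.1 0 = q.1 0) :
    ∃ r a', Chain g k r r a' ∧ |a' - a| ≤ ω 0 := by
  have hperiod : p.1 k = p.1 0 := (h.apply_eq 0).trans hpq.symm
  obtain ⟨r, hr⟩ := exists_periodic p hperiod
  have hrq : r.1 ∈ PiNat.cylinder q.1 (0 + 1) := by
    refine PiNat.mem_cylinder_iff.2 fun j hj => ?_
    obtain rfl : j = 0 := by omega
    rw [hr, Nat.zero_mod, hpq]
  obtain ⟨p', a', hchain, hp', ha'⟩ := hg.exists_chain h 0 r hrq
  have hpr : p' = r := by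
    refine Subtype.ext (funext fun j => ?_)
    rcases Nat.lt_or_ge j k with hj | hj
    · rw [PiNat.mem_cylinder_iff.1 hp' j hj, hr, Nat.mod_eq_of_lt hj]
    · obtain ⟨i, rfl⟩ := Nat.exists_eq_add_of_le hj
      rw [hchain.apply_eq, hr, hr, Nat.add_mod_left]
  exact ⟨r, a', hpr ▸ hchain, ha'⟩

end ClosedChains

section HolonomicMeasures

variable {g : NatExt M → ℝ} {ω : ℕ → ℝ}

instance : BorelSpace (NatExt M) := borelSpace_natExt M

theorem integrable_of_continuous (hg : Continuous g) (μ : Measure (NatExt M)) [IsFiniteMeasure μ] :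
    Integrable g μ :=
  hg.integrable_of_hasCompactSupport (HasCompactSupport.of_compactSpace g)

theorem Chain.exists_measure (hg : Continuous g) {k : ℕ} {p q : Shift M} {a : ℝ}
    (h : Chain g k p q a) : ∃ μ : Measure (NatExt M), μ Set.univ = k ∧ ∫ z, g z ∂μ = a ∧
      ∀ f : C(Shift M, ℝ), ∫ z, f (proj z) ∂μ - ∫ z, f (tau z) ∂μ = f q - f p := by
  induction h with
  | nil p => exact ⟨0, by simp⟩
  | @snoc k p a z _ ih =>
    obtain ⟨μ, hμ, hμg, hμf⟩ := ih
    have : IsFiniteMeasure μ := ⟨hμ ▸ ENNReal.natCast_lt_top k⟩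
    have hadd {f : NatExt M → ℝ} (hf : Continuous f) :
        ∫ z', f z' ∂(μ + Measure.dirac z) = ∫ z', f z' ∂μ + f z := by
      rw [integral_add_measure (integrable_of_continuous hf _) (integrable_of_continuous hf _),
        integral_dirac]
    refine ⟨μ + Measure.dirac z, by simp [hμ], by rw [hadd hg, hμg], fun f => ?_⟩
    have hproj := hadd (f.continuous.comp continuous_proj)
    have htau := hadd (f.continuous.comp continuous_tau)
    simp only [Function.comp_apply] at hproj htau
    rw [hproj, htau]
    linarith [hμf f]

theorem Chain.exists_isHolonomic (hg : Continuous g) {k : ℕ} (hk : 1 ≤ k) {r : Shift M} {a : ℝ}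
    (h : Chain g k r r a) : ∃ μ : Measure (NatExt M), IsHolonomic μ ∧ k * ∫ z, g z ∂μ = a := by
  obtain ⟨μ, hμ, hμg, hμf⟩ := h.exists_measure hg
  have hk0 : k ≠ 0 := by omega
  refine ⟨(k : ENNReal)⁻¹ • μ, ⟨⟨?_⟩, fun f => ?_⟩, ?_⟩
  · rw [Measure.smul_apply, hμ, smul_eq_mul, ENNReal.inv_mul_cancel (Nat.cast_ne_zero.2 hk0)
      (ENNReal.natCast_ne_top k)]
  · rw [integral_smul_measure, integral_smul_measure, sub_eq_zero.1 ((hμf f).trans (sub_self _))]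
  · rw [integral_smul_measure, hμg]
    simp [hk0]

variable {A : NatExt M → ℝ} {μ : Measure (NatExt M)}

theorem IsHolonomic.minValue_le (hA : Continuous A) (hμ : IsHolonomic μ) :
    minValue A ≤ ∫ z, A z ∂μ := by
  obtain ⟨G, hG⟩ := exists_abs_le hA
  refine csInf_le ⟨-G, ?_⟩ ⟨μ, hμ, rfl⟩
  rintro _ ⟨ν, ⟨_, -⟩, rfl⟩
  have hnorm := norm_integral_le_of_norm_le_const (μ := ν) (f := A) (.of_forall hG)
  rw [probReal_univ, mul_one] at hnorm
  exact (abs_le.1 hnorm).1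

theorem IsHolonomic.integral_normalized (hA : Continuous A) (hμ : IsHolonomic μ) :
    ∫ z, normalized A z ∂μ = ∫ z, A z ∂μ - minValue A := by
  have := hμ.1
  simp only [normalized]
  rw [integral_sub (integrable_of_continuous hA μ) (integrable_const _), integral_const,
    probReal_univ, one_smul]

theorem Chain.nonneg_of_closed (hA : Continuous A) {k : ℕ} {r : Shift M} {a : ℝ}
    (h : Chain (normalized A) k r r a) : 0 ≤ a := by
  rcases Nat.eq_zero_or_pos k with rfl | hk
  · cases h
    rfl
  · have hcont : Continuous (normalized A) := hA.sub continuous_const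
    obtain ⟨μ, hμ, rfl⟩ := h.exists_isHolonomic hcont hk
    rw [hμ.integral_normalized hA]
    exact mul_nonneg k.cast_nonneg (sub_nonneg.2 (hμ.minValue_le hA))

theorem IsWalters.exists_lower_bound (hA : IsWalters A ω) (hM : StronglyConnected M) :
    ∃ L, ∀ ⦃k p q a⦄, Chain (normalized A) k p q a → L ≤ a := by
  obtain ⟨D, hD⟩ := hM.exists_connection hA.normalized.continuous
  refine ⟨-ω 0 - D, fun k p q a h => ?_⟩
  obtain ⟨n, -, q', b, hb, hchain, hq'⟩ := hD (q.1 0) p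
  obtain ⟨r, a', hclosed, ha'⟩ :=
    hA.normalized.exists_closed_chain (hchain.trans h) hq'
  linarith [hclosed.nonneg_of_closed hA.continuous, (abs_le.1 ha').2]

theorem IsWalters.exists_isHolonomic (hg : IsWalters g ω) (hM : StronglyConnected M)
    [Nonempty (Shift M)] : ∃ μ : Measure (NatExt M), IsHolonomic μ := by
  obtain ⟨D, hD⟩ := hM.exists_connection hg.continuous
  obtain ⟨x⟩ := ‹Nonempty (Shift M)›
  obtain ⟨n, hn, p, b, -, hchain, hp⟩ := hD (x.1 0) x
  obtain ⟨r, a, hclosed, -⟩ := hg.exists_closed_chain hchain hp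
  obtain ⟨μ, hμ, -⟩ := hclosed.exists_isHolonomic hg.continuous hn
  exact ⟨μ, hμ⟩

end HolonomicMeasures

section LeastAction

variable {g : NatExt M → ℝ} {ω : ℕ → ℝ}

/-- The least action of the paths of length `k` that end at `x`. It is an honest infimum if `proj`
is onto, so that there are such paths, and `g` is bounded. -/
noncomputable def leastAction (g : NatExt M → ℝ) (k : ℕ) (x : Shift M) : ℝ :=
  sInf {a | ∃ p, Chain g k p x a}

variable {k : ℕ} {c : ℝ} {x : Shift M}

theorem exists_chain (hπ : Function.Surjective (proj : NatExt M → Shift M)) (g : NatExt M → ℝ)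
    (k : ℕ) (x : Shift M) : ∃ a p, Chain g k p x a := by
  induction k generalizing x with
  | zero => exact ⟨0, x, .nil x⟩
  | succ k ih =>
    obtain ⟨z, rfl⟩ := hπ x
    obtain ⟨a, p, h⟩ := ih (tau z)
    exact ⟨_, p, h.snoc z⟩

theorem leastAction_le (hg : Continuous g) {p : Shift M} {a : ℝ} (h : Chain g k p x a) :
    leastAction g k x ≤ a := by
  obtain ⟨G, hG⟩ := exists_abs_le hg
  refine csInf_le ⟨k * -G, ?_⟩ ⟨p, h⟩
  rintro b ⟨p, hb⟩
  clear h
  induction hb with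
  | nil => simp
  | snoc z _ ih =>
    push_cast
    linarith [(abs_le.1 (hG z)).1]

theorem le_leastAction (hπ : Function.Surjective (proj : NatExt M → Shift M))
    (h : ∀ p a, Chain g k p x a → c ≤ a) : c ≤ leastAction g k x :=
  le_csInf (exists_chain hπ g k x) fun a ⟨p, hp⟩ => h p a hp

theorem leastAction_proj_le (hπ : Function.Surjective (proj : NatExt M → Shift M))
    (hg : Continuous g) (k : ℕ) (z : NatExt M) :
    leastAction g (k + 1) (proj z) ≤ leastAction g k (tau z) + g z :=
  sub_le_iff_le_add.1 <| le_leastAction hπ fun _ _ h =>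
    sub_le_iff_le_add.2 (leastAction_le hg (h.snoc z))

namespace IsWalters

theorem continuous_leastAction (hg : IsWalters g ω)
    (hπ : Function.Surjective (proj : NatExt M → Shift M)) (k : ℕ) :
    Continuous (leastAction g k) := by
  refine continuous_of_le_add hg.tendsto_zero fun n x x' hx' => ?_
  refine sub_le_iff_le_add.1 (le_leastAction hπ fun p a h => ?_)
  obtain ⟨p', a', h', -, ha'⟩ := hg.exists_chain h n x' hx'
  linarith [(abs_le.1 ha').2, leastAction_le hg.continuous h']

theorem integral_leastAction_le (hg : IsWalters g ω)
    (hπ : Function.Surjective (proj : NatExt M → Shift M)) {μ : Measure (NatExt M)}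
    (hμ : IsHolonomic μ) (k : ℕ) : ∫ z, leastAction g k (proj z) ∂μ ≤ k * ∫ z, g z ∂μ := by
  have := hμ.1
  have hcont := hg.continuous_leastAction hπ
  induction k with
  | zero =>
    have hle : ∀ z, leastAction g 0 (proj z) ≤ 0 := fun z => leastAction_le hg.continuous (.nil _)
    simpa using integral_nonpos hle
  | succ k ih =>
    have hproj := integrable_of_continuous ((hcont (k + 1)).comp continuous_proj) μ
    have htau := integrable_of_continuous ((hcont k).comp continuous_tau) μ
    have hint := integrable_of_continuous hg.continuous μ
    have hinv : ∫ z, leastAction g k (tau z) ∂μ = ∫ z, leastAction g k (proj z) ∂μ :=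
      hμ.2 ⟨leastAction g k, hcont k⟩
    calc ∫ z, leastAction g (k + 1) (proj z) ∂μ
        ≤ ∫ z, leastAction g k (tau z) + g z ∂μ :=
          integral_mono hproj (htau.add hint) (leastAction_proj_le hπ hg.continuous k)
      _ = ∫ z, leastAction g k (proj z) ∂μ + ∫ z, g z ∂μ := by
          rw [← hinv]
          exact integral_add htau hint
      _ ≤ (k + 1 : ℕ) * ∫ z, g z ∂μ := by
          push_cast
          linarith

theorem le_mul_integral (hg : IsWalters g ω)
    (hπ : Function.Surjective (proj : NatExt M → Shift M)) {μ : Measure (NatExt M)}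
    (hμ : IsHolonomic μ) (h : ∀ p q a, Chain g k p q a → c ≤ a) : c ≤ k * ∫ z, g z ∂μ := by
  have := hμ.1
  have hint :=
    integrable_of_continuous ((hg.continuous_leastAction hπ k).comp continuous_proj) μ
  have hmono := integral_mono (integrable_const c) hint
    fun z => le_leastAction hπ fun p a => h p (proj z) a
  rw [integral_const, probReal_univ, one_smul] at hmono
  exact hmono.trans (hg.integral_leastAction_le hπ hμ k)

theorem exists_chain_le_one {A : NatExt M → ℝ} (hA : IsWalters A ω) (hM : StronglyConnected M)
    [Nonempty (Shift M)] (k : ℕ) : ∃ p q, ∃ a ≤ 1, Chain (normalized A) k p q a := by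
  by_contra! hne
  have hmul {μ : Measure (NatExt M)} (hμ : IsHolonomic μ) :
      1 ≤ k * (∫ z, A z ∂μ - minValue A) := by
    rw [← hμ.integral_normalized hA.continuous]
    exact hA.normalized.le_mul_integral hM.proj_surjective hμ fun p q a h =>
      (not_le.1 fun ha => hne p q a ha h).le
  obtain ⟨μ₀, hμ₀⟩ := hA.exists_isHolonomic hM
  have hk : (0 : ℝ) < k := (Nat.cast_nonneg k).lt_of_ne' fun hk => by
    linarith [hk ▸ hmul hμ₀]
  have hgap : minValue A + 1 / k ≤ minValue A := by
    refine le_csInf ⟨_, μ₀, hμ₀, rfl⟩ ?_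
    rintro _ ⟨μ, hμ, rfl⟩
    linarith [(div_le_iff₀' hk).2 (hmul hμ)]
  linarith [one_div_pos.2 hk]

end IsWalters

end LeastAction

section Composition

variable {g : NatExt M → ℝ} {ω : ℕ → ℝ} {w x x' r : Shift M} {c b : ℝ} {m n : ℕ}

theorem isCompact_setOf_chain (hg : Continuous g) (k : ℕ) :
    IsCompact {t : Shift M × Shift M × ℝ | Chain g k t.1 t.2.1 t.2.2} := by
  induction k with
  | zero =>
    have hdiag : Continuous fun p : Shift M => (p, p, (0 : ℝ)) := by fun_prop
    convert isCompact_range hdiag using 1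
    ext ⟨p, q, a⟩
    constructor
    · rintro ⟨⟩
      exact ⟨p, rfl⟩
    · rintro ⟨_, ⟨⟩⟩
      exact .nil p
  | succ k ih =>
    have hproj := continuous_proj (M := M)
    have htau := continuous_tau (M := M)
    have hmeet : IsClosed {y : NatExt M × Shift M × Shift M × ℝ | y.2.2.1 = tau y.1} :=
      isClosed_eq (by fun_prop) (by fun_prop)
    have hsnoc : Continuous fun y : NatExt M × Shift M × Shift M × ℝ =>
        (y.2.1, proj y.1, y.2.2.2 + g y.1) := by fun_prop
    convert ((isCompact_univ.prod ih).inter_right hmeet).image hsnoc using 1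
    ext ⟨p, q, a⟩
    constructor
    · intro h
      obtain ⟨z, rfl, hz⟩ := Chain.exists_snoc h
      exact ⟨(z, p, tau z, a - g z), ⟨⟨trivial, hz⟩, rfl⟩, by simp⟩
    · rintro ⟨⟨z, p, q, a⟩, ⟨⟨-, h⟩, hq⟩, ⟨⟩⟩
      obtain rfl : q = tau z := hq
      exact .snoc z h

theorem reaches_self_of_mem_closure (hg : Continuous g)
    (h : (w, w, (0 : ℝ)) ∈ closure
      {t : Shift M × Shift M × ℝ | ∃ k ≥ 1, Chain g k t.1 t.2.1 t.2.2}) :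
    Reaches g w w 0 := by
  intro N
  by_cases hloop : ∃ k ≥ 1, Chain g k w w 0
  · obtain ⟨k, hk, hchain⟩ := hloop
    exact subset_closure ⟨N * k, Nat.le_mul_of_pos_right N hk, 0, le_rfl,
      by simpa using hchain.iterate N⟩
  · -- The paths of length at most `N` form a compact set that misses `(w, w, 0)`.
    have hshort : IsClosed (⋃ k ∈ Set.Icc 1 N,
        {t : Shift M × Shift M × ℝ | Chain g k t.1 t.2.1 t.2.2}) :=
      (Set.finite_Icc 1 N).isClosed_biUnion fun k _ => (isCompact_setOf_chain hg k).isClosed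
    have hsplit : {t : Shift M × Shift M × ℝ | ∃ k ≥ 1, Chain g k t.1 t.2.1 t.2.2} ⊆
        (⋃ k ∈ Set.Icc 1 N, {t : Shift M × Shift M × ℝ | Chain g k t.1 t.2.1 t.2.2}) ∪
          {t | ∃ k ≥ N, ∃ a ≤ t.2.2, Chain g k t.1 t.2.1 a} := by
      rintro t ⟨k, hk, hchain⟩
      rcases le_total k N with hkN | hkN
      · exact .inl (Set.mem_biUnion (show k ∈ Set.Icc 1 N from ⟨hk, hkN⟩) hchain)
      · exact .inr ⟨k, hkN, _, le_rfl, hchain⟩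
    have hmem := closure_mono hsplit h
    rw [closure_union, hshort.closure_eq] at hmem
    refine hmem.resolve_left fun hmem => ?_
    obtain ⟨k, ⟨hk, -⟩, hchain⟩ := Set.mem_iUnion₂.1 hmem
    exact hloop ⟨k, hk, hchain⟩

namespace Reaches

theorem exists_reaches_tau (hg : Continuous g) (h : Reaches g w x c) :
    ∃ z, proj z = x ∧ Reaches g w (tau z) (c - g z) := by
  obtain ⟨k, p, q, a, b, hk, hp, hq, hb, hab, hchain⟩ := h.exists_seq
  have hlast (n : ℕ) : ∃ z k' a', proj z = q (n + 1) ∧ n ≤ k' ∧ a' ≤ b (n + 1) - g z ∧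
      Chain g k' (p (n + 1)) (tau z) a' := by
    obtain ⟨k', hk'⟩ := Nat.exists_eq_succ_of_ne_zero (Nat.ne_zero_of_lt (hk (n + 1)))
    obtain ⟨z, hz, hchain'⟩ := (hk' ▸ hchain (n + 1)).exists_snoc
    exact ⟨z, k', _, hz, by have := hk (n + 1); omega, sub_le_sub_right (hab (n + 1)) _, hchain'⟩
  choose z k' a' hz hk' ha' hchain' using hlast
  obtain ⟨ζ, φ, hφ, hζ⟩ := CompactSpace.tendsto_subseq z
  have hφ_succ : Tendsto (fun n => φ n + 1) atTop atTop :=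
    (tendsto_add_atTop_nat 1).comp hφ.tendsto_atTop
  have hproj : proj ζ = x := by
    refine tendsto_nhds_unique ((continuous_proj.tendsto ζ).comp hζ) ?_
    exact (hq.comp hφ_succ).congr fun n => (hz (φ n)).symm
  refine ⟨ζ, hproj, reaches_of_tendsto (tendsto_atTop_mono (fun n => hk' (φ n)) hφ.tendsto_atTop)
    (hp.comp hφ_succ) ((continuous_tau.tendsto ζ).comp hζ)
    ((hb.comp hφ_succ).sub ((hg.tendsto ζ).comp hζ)) (fun n => ha' (φ n)) fun n => hchain' (φ n)⟩

theorem le_of_forall_chain {L : ℝ} (hL : ∀ ⦃k p q a⦄, Chain g k p q a → L ≤ a)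
    (h : Reaches g w x c) : L ≤ c := by
  obtain ⟨k, p, q, a, b, -, -, -, hb, hab, hchain⟩ := h.exists_seq
  exact ge_of_tendsto' hb fun n => (hL (hchain n)).trans (hab n)

theorem trans_of_mem_cylinder (hg : IsWalters g ω) (h : Reaches g w x c)
    (hx : x'.1 ∈ PiNat.cylinder x.1 (n + 1)) (hxr : Chain g m x' r b) :
    Reaches g w r (c + ω n + b) := by
  obtain ⟨k, p, q, a, d, hk, hp, hq, hd, had, hchain⟩ := h.exists_seq
  obtain ⟨N, hN⟩ := eventually_atTop.1 (hq.eventually (eventually_mem_cylinder x (n + 1)))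
  have hmove (i : ℕ) := hg.exists_chain (hchain (i + N)) n x' (by
    rw [← PiNat.mem_cylinder_iff_eq.1 (hN (i + N) (Nat.le_add_left N i))] at hx
    exact hx)
  choose p' a' hchain' hp' ha' using hmove
  have hshift := tendsto_add_atTop_nat N
  have hk_tendsto : Tendsto (fun i => k (i + N)) atTop atTop :=
    (tendsto_atTop_mono hk tendsto_id).comp hshift
  refine reaches_of_tendsto (tendsto_atTop_mono (fun i => Nat.le_add_right _ m) hk_tendsto)
    (tendsto_of_mem_cylinder (hp.comp hshift) hk_tendsto hp') tendsto_const_nhds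
    (((hd.comp hshift).add_const (ω n)).add_const b) (fun i => ?_)
    fun i => (hchain' i).trans hxr
  dsimp only [Function.comp_apply]
  linarith [(abs_le.1 (ha' i)).2, had (i + N)]

theorem of_mem_cylinder (hg : IsWalters g ω) (h : Reaches g w x c)
    (hx : x'.1 ∈ PiNat.cylinder x.1 (n + 1)) : Reaches g w x' (c + ω n) := by
  simpa using h.trans_of_mem_cylinder hg hx (.nil x')

theorem trans_chain (hg : IsWalters g ω) (h : Reaches g w x c) (hxr : Chain g m x r b) :
    Reaches g w r (c + b) := by
  have happrox (n : ℕ) : Reaches g w r (c + ω n + b) :=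
    h.trans_of_mem_cylinder hg (PiNat.self_mem_cylinder x.1 (n + 1)) hxr
  have hlim : Tendsto (fun n => (w, r, c + ω n + b)) atTop (𝓝 (w, r, c + b)) := by
    simpa using tendsto_const_nhds.prodMk_nhds
      (tendsto_const_nhds.prodMk_nhds ((hg.tendsto_zero.const_add c).add_const b))
  exact (isClosed_setOf_reaches g).mem_of_tendsto hlim (.of_forall happrox)

theorem exists_reaches (hg : IsWalters g ω) (hM : StronglyConnected M) (h : Reaches g w x c)
    (r : Shift M) : ∃ d, Reaches g w r d := by
  obtain ⟨D, hD⟩ := hM.exists_connection hg.continuous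
  obtain ⟨n, -, p, b, -, hchain, hp⟩ := hD (x.1 0) r
  refine ⟨_, h.trans_of_mem_cylinder hg (n := 0) (PiNat.mem_cylinder_iff.2 fun j hj => ?_) hchain⟩
  obtain rfl : j = 0 := by omega
  exact hp

end Reaches

end Composition

section Envelope

variable {ω : ℕ → ℝ} {A : NatExt M → ℝ} {ι : Type*} {w : ι → Shift M} {φ : ι → ℝ}

theorem IsWalters.exists_isLeast (hA : IsWalters A ω) (hM : StronglyConnected M)
    [TopologicalSpace ι] [CompactSpace ι] (hw : Continuous w) (hφ : Continuous φ) {i : ι}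
    {y : Shift M} {c : ℝ} (hi : Reaches (normalized A) (w i) y c) (x : Shift M) :
    ∃ r, IsLeast {r | ∃ i, Reaches (normalized A) (w i) x (r - φ i)} r := by
  have hclosed : IsClosed {r | ∃ i, Reaches (normalized A) (w i) x (r - φ i)} := by
    have hmap : Continuous fun t : ι × ℝ => (w t.1, x, t.2 - φ t.1) := by fun_prop
    convert isClosedMap_snd_of_compactSpace _
      ((isClosed_setOf_reaches (normalized A)).preimage hmap) using 1
    ext r
    simp
  have hbdd : BddBelow {r | ∃ i, Reaches (normalized A) (w i) x (r - φ i)} := by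
    obtain ⟨L, hL⟩ := hA.exists_lower_bound hM
    obtain ⟨m, hm⟩ := (isCompact_range hφ).bddBelow
    refine ⟨L + m, fun r ⟨i, hr⟩ => ?_⟩
    linarith [hr.le_of_forall_chain hL, hm ⟨i, rfl⟩]
  obtain ⟨d, hd⟩ := hi.exists_reaches hA.normalized hM x
  exact ⟨_, hclosed.isLeast_csInf ⟨d + φ i, i, by rwa [add_sub_cancel_right]⟩ hbdd⟩

theorem IsWalters.isCalibrated_of_isLeast (hA : IsWalters A ω) {u : Shift M → ℝ}
    (hu : ∀ x, IsLeast {r | ∃ i, Reaches (normalized A) (w i) x (r - φ i)} (u x)) :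
    IsCalibrated A u := by
  have hle {i : ι} {x : Shift M} {c : ℝ} (h : Reaches (normalized A) (w i) x c) :
      u x ≤ c + φ i := (hu x).2 ⟨i, by rwa [add_sub_cancel_right]⟩
  have hcont : Continuous u := by
    refine continuous_of_le_add hA.tendsto_zero fun n x x' hx => ?_
    obtain ⟨i, hi⟩ := (hu x).1
    linarith [hle (hi.of_mem_cylinder hA.normalized hx)]
  have hsub (z : NatExt M) : u (proj z) - u (tau z) ≤ A z - minValue A := by
    obtain ⟨i, hi⟩ := (hu (tau z)).1
    have := hle (hi.trans_chain hA.normalized (.single _ z))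
    rw [normalized] at this
    linarith
  refine ⟨⟨hcont, hsub⟩, fun x => ⟨?_, ?_⟩⟩
  · obtain ⟨i, hi⟩ := (hu x).1
    obtain ⟨z, rfl, hz⟩ := hi.exists_reaches_tau hA.normalized.continuous
    have := hle hz
    rw [normalized] at this
    exact ⟨z, rfl, by linarith [hsub z]⟩
  · rintro _ ⟨z, rfl, rfl⟩
    linarith [hsub z]

theorem IsWalters.exists_isCalibrated (hA : IsWalters A ω) (hM : StronglyConnected M)
    [Nonempty (Shift M)] : ∃ u, IsCalibrated A u := by
  choose p q a ha hchain using hA.exists_chain_le_one hM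
  obtain ⟨⟨w, x⟩, φ, hφ, hlim⟩ := CompactSpace.tendsto_subseq fun k => (p k, q k)
  rw [nhds_prod_eq] at hlim
  have hreach : Reaches (normalized A) w x 1 :=
    reaches_of_tendsto hφ.tendsto_atTop hlim.fst hlim.snd tendsto_const_nhds (fun n => ha (φ n))
      fun n => hchain (φ n)
  choose u hu using hA.exists_isLeast hM (w := fun _ : Unit => w) (φ := fun _ => 0)
    continuous_const continuous_const (i := ()) hreach
  exact ⟨u, hA.isCalibrated_of_isLeast hu⟩

end Envelope

section NonWandering

variable {lam : ℝ} {ω : ℕ → ℝ} {A : NatExt M → ℝ}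

theorem Omega_nonempty (hA : IsWalters A ω) (hM : StronglyConnected M) (h0 : 0 < lam)
    (h1 : lam < 1) [hne : Nonempty (Shift M)] : (Omega lam A).Nonempty := by
  obtain ⟨u, hu⟩ := hA.exists_isCalibrated hM
  obtain ⟨w, hw, -⟩ := hu.exists_reaches h0 h1 hne.some
  exact ⟨w, hw⟩

theorem isClosed_Omega (hπ : Function.Surjective (proj : NatExt M → Shift M)) (h0 : 0 < lam)
    (h1 : lam < 1) : IsClosed (Omega lam A) := by
  have hdiag : Continuous fun w : Shift M => (w, w, (0 : ℝ)) := by fun_prop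
  have hpreimage : Omega lam A = _ := Set.ext fun w => mem_Omega_iff hπ h0 h1 (w := w)
  exact hpreimage ▸ isClosed_closure.preimage hdiag

theorem reaches_self_of_mem_Omega (hπ : Function.Surjective (proj : NatExt M → Shift M))
    (hA : Continuous A) (h0 : 0 < lam) (h1 : lam < 1) {w : Shift M} (hw : w ∈ Omega lam A) :
    Reaches (normalized A) w w 0 :=
  reaches_self_of_mem_closure (hA.sub continuous_const) ((mem_Omega_iff hπ h0 h1).1 hw)

theorem eq_of_isLeast (hπ : Function.Surjective (proj : NatExt M → Shift M)) (hA : Continuous A)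
    (h0 : 0 < lam) (h1 : lam < 1) {φ : Omega lam A → ℝ}
    (hφ : ∀ x w : Omega lam A, ((φ x - φ w : ℝ) : EReal) ≤ peierls lam A w x) (x : Omega lam A)
    {r : ℝ} (hr : IsLeast {r | ∃ w : Omega lam A, Reaches (normalized A) w x (r - φ w)} r) :
    r = φ x := by
  refine le_antisymm (hr.2 ⟨x, ?_⟩) ?_
  · rw [sub_self]
    exact reaches_self_of_mem_Omega hπ hA h0 h1 x.2
  · obtain ⟨w, hw⟩ := hr.1
    have hle : φ x - φ w ≤ r - φ w :=
      EReal.coe_le_coe_iff.1 ((hφ x w).trans ((peierls_le_coe_iff hπ h0 h1).2 hw))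
    linarith

end NonWandering

end Holonomic

open Holonomic in
theorem theorem3p5_general {s : ℕ} {M : Matrix (Fin s) (Fin s) ℤ}
    (hM : StronglyConnected M) {lam : ℝ} (hlam0 : 0 < lam) (hlam1 : lam < 1)
    {A : NatExt M → ℝ} {ω : ℕ → ℝ} (hA : IsWalters A ω) :
    (∀ u : Shift M → ℝ, IsCalibrated A u →
      ∀ x : Shift M,
        IsLeast (Set.range fun w : Omega lam A =>
          ((u w : ℝ) : EReal) + peierls lam A w x) ((u x : ℝ) : EReal)) ∧
    (∀ φ : Omega lam A → ℝ, Continuous φ →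
      (∀ x w : Omega lam A,
        ((φ x - φ w : ℝ) : EReal) ≤ peierls lam A w x) →
      ∃ u : Shift M → ℝ,
        (∀ x : Shift M,
          IsLeast (Set.range fun w : Omega lam A =>
            ((φ w : ℝ) : EReal) + peierls lam A w x) ((u x : ℝ) : EReal)) ∧
        IsCalibrated A u ∧
        ∀ w : Omega lam A, u w = φ w) := by
  have hπ := hM.proj_surjective
  refine ⟨fun u hu => hu.isLeast hlam0 hlam1, fun φ hφ hφle => ?_⟩
  have : CompactSpace (Omega lam A) :=
    isCompact_iff_compactSpace.1 (isClosed_Omega hπ hlam0 hlam1).isCompact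
  have hleast (x : Shift M) :
      ∃ r, IsLeast {r | ∃ w : Omega lam A,
        Reaches (normalized A) w x (r - φ w)} r := by
    have : Nonempty (Shift M) := ⟨x⟩
    obtain ⟨w, hw⟩ := Omega_nonempty hA hM hlam0 hlam1
    exact hA.exists_isLeast hM continuous_subtype_val hφ (i := ⟨w, hw⟩)
      (reaches_self_of_mem_Omega hπ hA.continuous hlam0 hlam1 hw) x
  choose u hu using hleast
  exact ⟨u, fun x => isLeast_range_add_peierls hπ hlam0 hlam1 (hu x),
    hA.isCalibrated_of_isLeast hu,
    fun w => eq_of_isLeast hπ hA.continuous hlam0 hlam1 hφle w (hu w)⟩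

theorem theorem3p5 {s : ℕ} (M : Matrix (Fin s) (Fin s) ℤ)
    (hM01 : ∀ i j, M i j = 0 ∨ M i j = 1) (hM : M.IsIrreducible)
    (lam θ : ℝ) (hlam0 : 0 < lam) (hlam1 : lam < 1) (hθ : 0 < θ)
    (A : Holonomic.NatExt M → ℝ) (hA : Holonomic.IsHolder lam θ A) :
    (∀ u : Holonomic.Shift M → ℝ, Holonomic.IsCalibrated A u →
      ∀ x : Holonomic.Shift M,
        IsLeast (Set.range fun w : Holonomic.Omega lam A =>
          ((u w : ℝ) : EReal) + Holonomic.peierls lam A w x) ((u x : ℝ) : EReal)) ∧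
    (∀ φ : Holonomic.Omega lam A → ℝ, Continuous φ →
      (∀ x w : Holonomic.Omega lam A,
        ((φ x - φ w : ℝ) : EReal) ≤ Holonomic.peierls lam A w x) →
      ∃ u : Holonomic.Shift M → ℝ,
        (∀ x : Holonomic.Shift M,
          IsLeast (Set.range fun w : Holonomic.Omega lam A =>
            ((φ w : ℝ) : EReal) + Holonomic.peierls lam A w x) ((u x : ℝ) : EReal)) ∧
        Holonomic.IsCalibrated A u ∧
        ∀ w : Holonomic.Omega lam A, u w = φ w) := by
  obtain ⟨ω, hω⟩ := hA.exists_isWalters hlam0 hlam1 hθ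
  exact theorem3p5_general (Holonomic.stronglyConnected_of_isIrreducible hM01 hM) hlam0 hlam1 hω
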